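/- For a positive integer $k$, let $\mathbb{R}_k^+$ be the set of real polynomials $a_0+a_1s+\dots+a_ks^k$ of degree $k$ with all coefficients $a_0,\dots,a_k$ positive, and let $\mathcal{H}_k\subset\mathbb{R}_k^+$ be the subset of those that are (Hurwitz) stable, i.e. all of whose complex zeros have negative real part. For $f(s)=\sum_{i=0}^n a_is^i$ of degree $n$ and $g(s)=\sum_{i=0}^m b_is^i$ of degree $m\le n$, the generalized Hadamard product of $f$ and $g$ is the set of polynomials $f\bullet g=\{F_0,\dots,F_{n-m}\}$, where $F_j(s)=\sum_{i=0}^m a_{j+i}b_is^i$ for $j=0,\dots,n-m$. Theorem. Let $n$ be a positive integer and suppose that $f\in\mathbb{R}_n^+$ ($f$ need not be stable). Then for every $m\in\{1,\dots,n\}$ there exists a polynomial $g\in\mathcal{H}_m$ such that $f\bullet g\subset\mathcal{H}_m$. -/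

import Mathlib

open Polynomial

namespace GenHadamard

/-- The set of real polynomials of degree `n` all of whose coefficients `a₀, …, aₙ` are positive. -/
def PosCoeff (n : ℕ) : Set ℝ[X] :=
  {f | f.natDegree = n ∧ ∀ i ≤ n, 0 < f.coeff i}

/-- Hurwitz stability: every complex zero has negative real part. -/
def IsStable (f : ℝ[X]) : Prop :=
  ∀ z : ℂ, aeval z f = 0 → z.re < 0

/-- The stable polynomials of degree `n` with positive coefficients. -/
def StablePoly (n : ℕ) : Set ℝ[X] :=
  {f | f ∈ PosCoeff n ∧ IsStable f}

/-- The Hadamard (coefficientwise) product. Coefficients beyond the smaller of the two degrees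
vanish, so summing up to the degree of `g` is enough. -/
noncomputable def hadamard (f g : ℝ[X]) : ℝ[X] :=
  ∑ i ∈ Finset.range (g.natDegree + 1), C (f.coeff i * g.coeff i) * X ^ i

/-- The segment `a_j + a_{j+1} s + ⋯ + a_{j+m} s ^ m` of `f = a₀ + a₁ s + ⋯ + aₙ s ^ n`. -/
noncomputable def coeffSegment (f : ℝ[X]) (m j : ℕ) : ℝ[X] :=
  ∑ i ∈ Finset.range (m + 1), C (f.coeff (j + i)) * X ^ i

/-- The generalized Hadamard product of `f` (degree `n`) and `g` (degree `m ≤ n`): the set of the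
Hadamard products of `g` with the segments of `f` of length `m + 1` starting at `j = 0, …, n - m`.
The range of `j` is written as `j + m ≤ n`. -/
def genHadamard (f g : ℝ[X]) : Set ℝ[X] :=
  {F | ∃ j : ℕ, j + g.natDegree ≤ f.natDegree ∧ F = hadamard (coeffSegment f g.natDegree j) g}

end GenHadamard

/-!
The multiplier is `g = ∑ t ^ (i ^ 2) s ^ i` with `t > 0` small. Multiplying by `t ^ (i ^ 2)` makes
any fixed positive sequence as strongly log-concave as desired, and there are only finitely many
segments of `f`, so one `t` serves them all (and `g` itself, which is the case of a constant
sequence).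

A polynomial `∑ c i * z ^ i` whose coefficients are strongly log-concave has no zero in the closed
right half-plane (`sum_ne_zero_of_strongly_logConcave`). Indeed, write `T i = c i * ‖z‖ ^ i`.
Strong log-concavity says that among any two terms whose indices differ by at least two, one is
much smaller than the largest `T k`. Hence the terms which are not negligible lie at two adjacent
indices `s, s + 1`, and for `0 ≤ re z` the sum of these two has modulus at least that of each of
them, so it exceeds all the remaining terms together.
-/

namespace GenHadamard

lemma coeff_sum_range_C_mul_X_pow (c : ℕ → ℝ) (m k : ℕ) :
    (∑ i ∈ Finset.range (m + 1), C (c i) * X ^ i).coeff k = if k ≤ m then c k else 0 := by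
  simp [Polynomial.coeff_C_mul, Polynomial.coeff_X_pow]

/-- In the closed right half-plane neither of two adjacent terms is larger than their sum. -/
lemma adjacent_terms_le_norm_add {a b : ℝ} (ha : 0 ≤ a) (hb : 0 ≤ b) {z : ℂ} (hz : 0 ≤ z.re)
    (s : ℕ) :
    a * ‖z‖ ^ s ≤ ‖(a : ℂ) * z ^ s + b * z ^ (s + 1)‖ ∧
      b * ‖z‖ ^ (s + 1) ≤ ‖(a : ℂ) * z ^ s + b * z ^ (s + 1)‖ := by
  have hfac : (a : ℂ) * z ^ s + b * z ^ (s + 1) = z ^ s * (a + b * z) := by ring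
  rw [hfac, norm_mul, norm_pow]
  have h1 : a ≤ ‖(a : ℂ) + b * z‖ := by
    refine le_trans ?_ (Complex.re_le_norm _)
    simpa using mul_nonneg hb hz
  have h2 : b * ‖z‖ ≤ ‖(a : ℂ) + b * z‖ := by
    refine le_of_sq_le_sq ?_ (norm_nonneg _)
    rw [mul_pow, Complex.sq_norm, Complex.sq_norm, Complex.normSq_apply, Complex.normSq_apply]
    simp only [Complex.add_re, Complex.add_im, Complex.mul_re, Complex.mul_im, Complex.ofReal_re,
      Complex.ofReal_im]
    nlinarith [mul_nonneg (mul_nonneg ha hb) hz, sq_nonneg a]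
  have hp : 0 ≤ ‖z‖ ^ s := by positivity
  constructor
  · nlinarith
  · rw [pow_succ]; nlinarith

/-- The sum has `m + 2` terms, of which the last is zero, so that the pair `s, s + 1` of dominant
indices lies in the range of summation also when `s = m`. -/
lemma sum_ne_zero_of_strongly_logConcave (m : ℕ) (c : ℕ → ℝ) (hc : ∀ i, 0 ≤ c i) (h0 : 0 < c 0)
    (hm : ∀ i, m < i → c i = 0)
    (hlc : ∀ i d, ((m : ℝ) + 3) ^ 2 * (c i * c (i + d + 2)) ≤ c (i + 1) * c (i + d + 1))
    (z : ℂ) (hz : 0 ≤ z.re) :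
    ∑ i ∈ Finset.range (m + 2), (c i : ℂ) * z ^ i ≠ 0 := by
  classical
  intro hsum
  set T : ℕ → ℝ := fun i => c i * ‖z‖ ^ i with hT
  have hTnn : ∀ i, 0 ≤ T i := fun i => mul_nonneg (hc i) (by positivity)
  obtain ⟨k, hk, hmax⟩ := Finset.exists_max_image (Finset.range (m + 2)) T ⟨0, by simp⟩
  have hmax' : ∀ i, T i ≤ T k := by
    intro i
    by_cases hi : i < m + 2
    · exact hmax i (Finset.mem_range.2 hi)
    · have : T i = 0 := by simp [hT, hm i (by omega)]
      rw [this]; exact hTnn k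
  have hTk : 0 < T k := lt_of_lt_of_le (by simpa [hT] using h0) (hmax' 0)
  have hkm : k ≤ m := by
    by_contra h
    have : T k = 0 := by simp [hT, hm k (by omega)]
    linarith
  set N : ℝ := (m : ℝ) + 3 with hN
  have hNpos : 0 < N := by positivity
  have hfar : ∀ i l, i + 2 ≤ l → ¬ (T k < N * T i ∧ T k < N * T l) := by
    rintro i l hil ⟨hi, hl⟩
    obtain ⟨d, rfl⟩ := Nat.exists_eq_add_of_le hil
    have h1 : N ^ 2 * (T i * T (i + 2 + d)) ≤ T (i + 1) * T (i + d + 1) := by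
      have := mul_le_mul_of_nonneg_right (hlc i d) (pow_nonneg (norm_nonneg z) (i + (i + d + 2)))
      calc N ^ 2 * (T i * T (i + 2 + d))
          = N ^ 2 * (c i * c (i + d + 2)) * ‖z‖ ^ (i + (i + d + 2)) := by
            rw [show i + 2 + d = i + d + 2 by omega]; simp only [hT]; ring
        _ ≤ c (i + 1) * c (i + d + 1) * ‖z‖ ^ (i + (i + d + 2)) := this
        _ = T (i + 1) * T (i + d + 1) := by simp only [hT]; ring
    have h2 : T (i + 1) * T (i + d + 1) ≤ T k * T k :=
      mul_le_mul (hmax' _) (hmax' _) (hTnn _) hTk.le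
    have h3 : T k * T k < N * T i * (N * T (i + 2 + d)) := mul_lt_mul'' hi hl hTk.le hTk.le
    nlinarith
  -- `s` is the least index of a term that is not negligible.
  have hex : ∃ s, T k < N * T s := ⟨k, by nlinarith [(Nat.cast_nonneg m : (0 : ℝ) ≤ m)]⟩
  obtain ⟨hs, hsmin⟩ := And.intro (Nat.find_spec hex) (fun i => Nat.find_min hex (m := i))
  have hsk : Nat.find hex ≤ k :=
    Nat.find_min' hex (by nlinarith [(Nat.cast_nonneg m : (0 : ℝ) ≤ m)])
  set s := Nat.find hex with hsdef
  have hother : ∀ i, i ≠ s → i ≠ s + 1 → N * T i ≤ T k := by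
    intro i h1 h2
    by_contra! h
    rcases lt_or_ge i s with h3 | h3
    · exact hsmin i h3 h
    · exact hfar s i (by omega) ⟨hs, h⟩
  have hks : k = s ∨ k = s + 1 := by
    by_contra! h
    have := hother k h.1 h.2
    nlinarith [(Nat.cast_nonneg m : (0 : ℝ) ≤ m)]
  have hpair : T k ≤ ‖(c s : ℂ) * z ^ s + c (s + 1) * z ^ (s + 1)‖ := by
    have h := adjacent_terms_le_norm_add (hc s) (hc (s + 1)) hz s
    rcases hks with h' | h'
    · simpa only [hT, h'] using h.1
    · simpa only [hT, h'] using h.2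
  have hsub : ({s, s + 1} : Finset ℕ) ⊆ Finset.range (m + 2) := by
    intro i hi
    simp only [Finset.mem_insert, Finset.mem_singleton] at hi
    exact Finset.mem_range.2 (by omega)
  rw [← Finset.sum_sdiff hsub, Finset.sum_pair (by omega)] at hsum
  have hrest : ‖∑ i ∈ Finset.range (m + 2) \ {s, s + 1}, (c i : ℂ) * z ^ i‖
      ≤ (m + 2 : ℕ) * (T k / N) := by
    have hle : ∀ i ∈ Finset.range (m + 2) \ {s, s + 1}, ‖(c i : ℂ) * z ^ i‖ ≤ T k / N := by
      intro i hi
      simp only [Finset.mem_sdiff, Finset.mem_insert, Finset.mem_singleton, not_or] at hi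
      rw [le_div_iff₀' hNpos, norm_mul, norm_pow, Complex.norm_of_nonneg (hc i)]
      exact hother i hi.2.1 hi.2.2
    refine (norm_sum_le_of_le _ hle).trans ?_
    rw [Finset.sum_const, nsmul_eq_mul]
    have hcard : (Finset.range (m + 2) \ {s, s + 1}).card ≤ m + 2 := by
      simpa using Finset.card_le_card (Finset.sdiff_subset (s := Finset.range (m + 2))
        (t := {s, s + 1}))
    gcongr
  have hlt : ((m + 2 : ℕ) : ℝ) * (T k / N) < T k := by
    rw [mul_div_assoc', div_lt_iff₀ hNpos, mul_comm (T k)]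
    apply mul_lt_mul_of_pos_right _ hTk
    rw [hN]; push_cast; linarith
  rw [eq_neg_of_add_eq_zero_right hsum, norm_neg] at hpair
  linarith

/-- A positive sequence whose terms are within a factor `D` of each other gives a stable polynomial
after multiplication by `t ^ (i ^ 2)`, where `t = 1 / (D (m + 3))` depends on `D` and `m` only. -/
lemma mem_stablePoly_of_coeff_eq (m : ℕ) (D : ℝ) (hD : 1 ≤ D) (a : ℕ → ℝ)
    (ha : ∀ i ≤ m, 0 < a i) (haD : ∀ p ≤ m, ∀ q ≤ m, a p ≤ D * a q) (F : ℝ[X])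
    (hF : ∀ k, F.coeff k = if k ≤ m then a k * (1 / (D * (m + 3))) ^ (k ^ 2) else 0) :
    F ∈ StablePoly m := by
  have hDpos : 0 < D := by linarith
  set t : ℝ := 1 / (D * (m + 3)) with ht
  have htpos : 0 < t := by positivity
  have hpos : ∀ i ≤ m, 0 < F.coeff i := by
    intro i hi
    rw [hF, if_pos hi]
    exact mul_pos (ha i hi) (by positivity)
  have hzero : ∀ i, m < i → F.coeff i = 0 := fun i hi => by rw [hF, if_neg (by omega)]
  have hnn : ∀ i, 0 ≤ F.coeff i := fun i => by
    rcases le_or_gt i m with h | h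
    · exact (hpos i h).le
    · exact (hzero i h).ge
  have hdeg : F.natDegree = m :=
    Polynomial.natDegree_eq_of_le_of_coeff_ne_zero
      (Polynomial.natDegree_le_iff_coeff_eq_zero.2 hzero) (hpos m le_rfl).ne'
  refine ⟨⟨hdeg, hpos⟩, ?_⟩
  intro z hz
  by_contra! hre
  refine sum_ne_zero_of_strongly_logConcave m F.coeff hnn (hpos 0 (Nat.zero_le m)) hzero ?_ z hre ?_
  · intro i d
    rcases le_or_gt (i + d + 2) m with h | h
    · rw [hF i, hF (i + d + 2), hF (i + 1), hF (i + d + 1), if_pos (by omega), if_pos h,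
        if_pos (by omega), if_pos (by omega)]
      have ht1 : t ≤ 1 := by
        rw [ht, div_le_one (by positivity)]
        nlinarith [(Nat.cast_nonneg m : (0 : ℝ) ≤ m)]
      have htN : t ^ 2 * D ^ 2 * ((m : ℝ) + 3) ^ 2 = 1 := by rw [ht]; field_simp
      have hprod : a i * a (i + d + 2) ≤ (D * a (i + 1)) * (D * a (i + d + 1)) :=
        mul_le_mul (haD _ (by omega) _ (by omega)) (haD _ h _ (by omega)) (ha _ h).le
          (mul_nonneg hDpos.le (ha _ (by omega)).le)
      -- The exponents satisfy `i² + (i+d+2)² = (i+1)² + (i+d+1)² + 2 (d+1)`.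
      have hexp : t ^ (i ^ 2) * t ^ ((i + d + 2) ^ 2)
          = t ^ ((i + 1) ^ 2) * t ^ ((i + d + 1) ^ 2) * (t ^ 2 * t ^ (2 * d)) := by
        simp only [← pow_add]; congr 1; ring
      have htd : t ^ (2 * d) ≤ 1 := pow_le_one₀ htpos.le ht1
      have hA : 0 < a (i + 1) := ha _ (by omega)
      have hB : 0 < a (i + d + 1) := ha _ (by omega)
      calc ((m : ℝ) + 3) ^ 2
            * (a i * t ^ (i ^ 2) * (a (i + d + 2) * t ^ ((i + d + 2) ^ 2)))
          = ((m : ℝ) + 3) ^ 2 * (a i * a (i + d + 2))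
            * (t ^ (i ^ 2) * t ^ ((i + d + 2) ^ 2)) := by ring
        _ ≤ ((m : ℝ) + 3) ^ 2 * ((D * a (i + 1)) * (D * a (i + d + 1)))
            * (t ^ ((i + 1) ^ 2) * t ^ ((i + d + 1) ^ 2) * (t ^ 2 * 1)) := by
            rw [hexp]; gcongr
        _ = (t ^ 2 * D ^ 2 * ((m : ℝ) + 3) ^ 2)
            * (a (i + 1) * t ^ ((i + 1) ^ 2) * (a (i + d + 1) * t ^ ((i + d + 1) ^ 2))) := by ring
        _ = _ := by rw [htN, one_mul]
    · rw [hzero _ h, mul_zero, mul_zero]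
      exact mul_nonneg (hnn _) (hnn _)
  · rw [Polynomial.aeval_eq_sum_range' (n := m + 2) (by omega)] at hz
    simpa [Algebra.smul_def] using hz

lemma exists_ratio_bound (n : ℕ) (a : ℕ → ℝ) (ha : ∀ i ≤ n, 0 < a i) :
    ∃ D : ℝ, 1 ≤ D ∧ ∀ p ≤ n, ∀ q ≤ n, a p ≤ D * a q := by
  classical
  obtain ⟨D, hD⟩ := Finset.exists_le
    ((Finset.range (n + 1) ×ˢ Finset.range (n + 1)).image fun x => a x.1 / a x.2)
  have h : ∀ p ≤ n, ∀ q ≤ n, a p / a q ≤ D := fun p hp q hq =>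
    hD _ (Finset.mem_image.2 ⟨(p, q), by simp; omega, rfl⟩)
  refine ⟨D, ?_, fun p hp q hq => (div_le_iff₀ (ha q hq)).1 (h p hp q hq)⟩
  simpa [div_self (ha 0 (Nat.zero_le n)).ne'] using h 0 (Nat.zero_le n) 0 (Nat.zero_le n)

end GenHadamard

open GenHadamard in
theorem theorem7 (n : ℕ) (f : ℝ[X]) (hf : f ∈ GenHadamard.PosCoeff n) :
    ∀ m ∈ Finset.Icc 1 n, ∃ g ∈ GenHadamard.StablePoly m,
      GenHadamard.genHadamard f g ⊆ GenHadamard.StablePoly m := by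
  intro m _
  obtain ⟨hdeg, hpos⟩ := hf
  obtain ⟨D, hD1, hD⟩ := exists_ratio_bound n f.coeff hpos
  set t : ℝ := 1 / (D * (m + 3)) with ht
  set g : ℝ[X] := ∑ i ∈ Finset.range (m + 1), C (t ^ (i ^ 2)) * X ^ i with hg
  have hgc : ∀ k, g.coeff k = if k ≤ m then t ^ (k ^ 2) else 0 :=
    coeff_sum_range_C_mul_X_pow (fun i => t ^ (i ^ 2)) m
  have hgS : g ∈ StablePoly m :=
    mem_stablePoly_of_coeff_eq m D hD1 (fun _ => 1) (fun _ _ => one_pos)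
      (fun _ _ _ _ => by simpa using hD1) g (fun k => by rw [hgc k, one_mul])
  refine ⟨g, hgS, ?_⟩
  rintro F ⟨j, hj, rfl⟩
  rw [hgS.1.1] at hj ⊢
  rw [hdeg] at hj
  refine mem_stablePoly_of_coeff_eq m D hD1 (fun i => f.coeff (j + i))
    (fun i hi => hpos _ (by omega))
    (fun p hp q hq => hD _ (by omega) _ (by omega)) _ (fun k => ?_)
  rw [hadamard, hgS.1.1,
    coeff_sum_range_C_mul_X_pow (fun i => (coeffSegment f m j).coeff i * g.coeff i)]
  by_cases hk : k ≤ m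
  · simp only [if_pos hk, hgc, coeffSegment]
    rw [coeff_sum_range_C_mul_X_pow (fun i => f.coeff (j + i)), if_pos hk]
  · simp only [if_neg hk]
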